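/- **Definitions.** Let $G$ be a finite additive group of order $n$ and $G^*=G\setminus\{0\}$. For $D\subseteq G$ let $\Delta(D)$ be the multiset $\{x-y : x,y\in D,\ x\ne y\}$, and for disjoint $D,D'\subseteq G$ let $\Delta(D,D')$ be the multiset $\{x-y: x\in D,\ y\in D'\}$. For a set $S$ and an integer $\lambda\ge 0$, $\lambda S$ is the multiset of $\lambda$ copies of each element of $S$; unions and sums of multisets below count multiplicity. A $k$-subset $D$ of $G$ is an $(n,k,\lambda)$-difference set if $\Delta(D)=\lambda G^*$. Let $D_1,\dots,D_m$ be pairwise disjoint $k$-subsets of $G$ with union $S$. The family $\{D_1,\dots,D_m\}$ is - an $(n,m,k,\lambda)$-DDF (disjoint difference family) if $\bigcup_i\Delta(D_i)=\lambda G^*$; - an $(n,m,k,\lambda)$-EDF (external difference family) if $\bigcup_{i\neq j}\Delta(D_i,D_j)=\lambda G^*$; - an $(n,m,k,\lambda,\mu)$-DPDF (disjoint partial difference family) if $S\subseteq G^*$ and $\bigcup_i\Delta(D_i)=\lambda S+\mu(G^*\setminus S)$; - an $(n,m,k,\lambda,\mu)$-EPDF (external partial difference family) if $S\subseteq G^*$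 and $\bigcup_{i\ne j}\Delta(D_i,D_j)=\lambda S+\mu(G^*\setminus S)$. A family or set is called a DDF, an EDF or a difference set, without parameters, if it is one for some parameters. **Theorem.** Let $q$ be a prime power, $\beta\ge 1$ an integer, $q'=q^{2\beta}$, and let $\mathrm{GF}(q')$ be the finite field of order $q'$, regarded as an additive group, with primitive element $\alpha$. Let $e\ge 3$ with $e\mid q+1$, and let $\eta=\frac{(-q)^{\beta}-1}{e}$, which is an integer. For $0\le i\le e-1$ let $C_i^e=\alpha^i\langle\alpha^e\rangle$ be the cyclotomic classes of order $e$. Let $u,w\ge 1$ be integers with $wu\le e$, and let $I_1,\dots,I_w\subseteq\{0,1,\dots,e-1\}$ be pairwise disjoint with $|I_a|=u$ for each $a$. Put $D_a=\bigcup_{i\in I_a}C_i^e$ and $\mathcal W'=\{D_1,\dots,D_w\}$. Then: 1. $\mathcal W'$ is a $\bigl(q',\,w,\,u\frac{q'-1}{e},\,u^2\eta^2+(3u-e)\eta-1+(w-1)(u^2\eta^2+u\eta),\,w(u^2\eta^2+u\eta)\bigr)$-DPDF. 2. If $w\ge 2$, then $\mathcal W'$ is a $\bigl(q',\,w,\,u\frac{q'-1}{e},\,w(w-1)u^2\eta^2+2(w-1)u\eta,\,w(w-1)u^2\eta^2\bigr)$-EPDF.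 3. If $\mathcal W'$ does not partition $\mathrm{GF}(q')^*=\mathrm{GF}(q')\setminus\{0\}$, then $\mathcal W'$ is a DDF if and only if every $D_a$ is a difference set. 4. If $w\ge 2$ and $\mathcal W'$ does not partition $\mathrm{GF}(q')^*$, then $\mathcal W'$ is not an EDF. -/

import Mathlib

section DifferenceFamilies

variable {G : Type*} [AddGroup G] [Fintype G] [DecidableEq G]

/-- The finite set of non-zero elements of `G`. -/
def nonzeroElems (G : Type*) [AddGroup G] [Fintype G] [DecidableEq G] : Finset G :=
  Finset.univ.erase 0

/-- The multiset of internal differences `x - y`, over ordered pairs `x ≠ y` in `A`. -/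
def intDiff (A : Finset G) : Multiset G :=
  A.offDiag.val.map (fun p => p.1 - p.2)

/-- The multiset of external differences `x - y`, with `x ∈ A` and `y ∈ B`. -/
def extDiff (A B : Finset G) : Multiset G :=
  (A ×ˢ B).val.map (fun p => p.1 - p.2)

/-- The multiset union of the internal differences of all members of a family. -/
def familyInt {m : ℕ} (D : Fin m → Finset G) : Multiset G :=
  ∑ i, intDiff (D i)

/-- The multiset union of the external differences over ordered pairs of distinct members
of a family. -/
def familyExt {m : ℕ} (D : Fin m → Finset G) : Multiset G :=
  ∑ p ∈ (Finset.univ : Finset (Fin m)).offDiag, extDiff (D p.1) (D p.2)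

/-- The union of the members of a family. -/
def familyUnion {m : ℕ} (D : Fin m → Finset G) : Finset G :=
  Finset.univ.biUnion D

/-- `A` is an `(n, k, lam)`-difference set in `G`. -/
structure IsDifferenceSet (n k lam : ℕ) (A : Finset G) : Prop where
  card_group : Fintype.card G = n
  card_set : A.card = k
  diff_eq : intDiff A = lam • (nonzeroElems G).val

/-- `D` is a family of `m` pairwise disjoint `k`-subsets of a group of order `n`. -/
structure IsDisjointFamily (n m k : ℕ) (D : Fin m → Finset G) : Prop where
  card_group : Fintype.card G = n
  card_set : ∀ i, (D i).card = k
  disjoint : ∀ i j, i ≠ j → Disjoint (D i) (D j)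

/-- `D` is an `(n, m, k, lam)`-disjoint difference family in `G`. -/
structure IsDDF (n m k lam : ℕ) (D : Fin m → Finset G) : Prop
    extends IsDisjointFamily n m k D where
  diff_eq : familyInt D = lam • (nonzeroElems G).val

/-- `D` is an `(n, m, k, lam)`-external difference family in `G`. -/
structure IsEDF (n m k lam : ℕ) (D : Fin m → Finset G) : Prop
    extends IsDisjointFamily n m k D where
  diff_eq : familyExt D = lam • (nonzeroElems G).val

/-- `D` is an `(n, m, k, lam, mu)`-disjoint partial difference family in `G`. -/
structure IsDPDF (n m k lam mu : ℕ) (D : Fin m → Finset G) : Prop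
    extends IsDisjointFamily n m k D where
  zero_notMem : ∀ i, (0 : G) ∉ D i
  diff_eq : familyInt D =
    lam • (familyUnion D).val + mu • (nonzeroElems G \ familyUnion D).val

/-- `D` is an `(n, m, k, lam, mu)`-external partial difference family in `G`. -/
structure IsEPDF (n m k lam mu : ℕ) (D : Fin m → Finset G) : Prop
    extends IsDisjointFamily n m k D where
  zero_notMem : ∀ i, (0 : G) ∉ D i
  diff_eq : familyExt D =
    lam • (familyUnion D).val + mu • (nonzeroElems G \ familyUnion D).val

/-- The members of `D` partition the set of non-zero elements of `G`. -/
structure PartitionsNonzero {m : ℕ} (D : Fin m → Finset G) : Prop where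
  nonempty : ∀ i, (D i).Nonempty
  disjoint : ∀ i j, i ≠ j → Disjoint (D i) (D j)
  union_eq : familyUnion D = nonzeroElems G

end DifferenceFamilies

open Classical in
/-- The cyclotomic class `α ^ i ⟨α ^ e⟩` of order `e`, as a finite subset of the field. -/
noncomputable def cyclotomicClass {F : Type*} [Field F] [Fintype F] (α : Fˣ) (e i : ℕ) :
    Finset F :=
  Finset.univ.filter (fun x => ∃ y ∈ Subgroup.zpowers (α ^ e), x = ((α ^ i * y : Fˣ) : F))

/-- The integer `((-q) ^ β - 1) / e`; the division is exact when `e ∣ q + 1`, see `mul_cycEta`. -/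
def cycEta (q β e : ℕ) : ℤ := ((-(q : ℤ)) ^ β - 1) / (e : ℤ)

theorem mul_cycEta {q e : ℕ} (β : ℕ) (h : e ∣ q + 1) :
    (e : ℤ) * cycEta q β e = (-(q : ℤ)) ^ β - 1 := by
  apply Int.mul_ediv_cancel'
  have h1 : (e : ℤ) ∣ (q : ℤ) + 1 := by exact_mod_cast h
  have h2 : (e : ℤ) ∣ -(q : ℤ) - 1 := by
    have h3 := (dvd_neg (a := (e : ℤ))).mpr h1
    have h4 : -((q : ℤ) + 1) = -(q : ℤ) - 1 := by ring
    rwa [h4] at h3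
  exact h2.trans (by simpa using sub_dvd_pow_sub_pow (-(q : ℤ)) 1 β)

/-! ### Power maps on the cyclic group of units. -/

section CyclicPowers

variable {F : Type*} [Field F] [Fintype F] [DecidableEq F]

/-! The classes are in the semiprimitive (uniform) case of cyclotomy: since `e ∣ q + 1`, each `D a`
is invariant under multiplication by `(q + 1)`-th powers, and for such sets every character sum
takes only two values.

Put `s = (-q) ^ β`, so that `s ^ 2 = |F|`. For a suitable additive character `ψ`, the sum of `ψ (b *
x ^ (q + 1))` over `x` has square `|F|` times the number of roots of an additive polynomial, which
is `q ^ 2` for `b` in one coset of the `(q + 1)`-th powers and `1` otherwise (`powerExpSum_sq`). The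
sum is also congruent to `1` modulo `q + 1` among algebraic integers, which fixes its sign: it is
`-q * s` or `s` (`exists_powerExpSum_eq`).

Averaging over `(q + 1)`-th powers, an invariant set `D` of size `t * (s + 1)` has character sum `t
- s * [c / a ∈ D]` at each `a ≠ 0` (`charSum_eq`). The exceptional frequencies form an invariant set
of the same size, whose own transform is therefore known (`sum_dual_eq`). Fourier inversion then
gives exact difference counts (`exists_uniform_counts`).

With `t = u * η`, summing over the family shows that internal and external differences each have one
multiplicity on the union and one off it. The gaps are `2 * t - s` and `2 * (w - 1) * t`. The first
also decides whether a single `D a` is a difference set; the second is nonzero for `w ≥ 2`. -/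

theorem exists_pow_eq_of_pow_eq_one {k m : ℕ} (hkm : k * m = Fintype.card Fˣ) {z : Fˣ}
    (hz : z ^ m = 1) : ∃ y : Fˣ, y ^ k = z := by
  obtain ⟨g, hg⟩ := IsCyclic.exists_generator (α := Fˣ)
  obtain ⟨i, rfl⟩ := (Submonoid.mem_powers_iff _ _).1 (mem_powers_iff_mem_zpowers.2 (hg z))
  rw [← pow_mul] at hz
  have hord : orderOf g = k * m := by
    rw [orderOf_eq_card_of_forall_mem_zpowers hg, Nat.card_eq_fintype_card, hkm]
  have hdvd := orderOf_dvd_of_pow_eq_one hz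
  rw [hord] at hdvd
  have hm : 0 < m := Nat.pos_of_ne_zero fun h => by
    have := Fintype.card_pos (α := Fˣ); simp [h] at hkm; omega
  obtain ⟨j, rfl⟩ := Nat.dvd_of_mul_dvd_mul_right hm hdvd
  exact ⟨g ^ j, by rw [← pow_mul, mul_comm]⟩

theorem card_units_pow_eq {k m : ℕ} (hkm : k * m = Fintype.card Fˣ) (y : Fˣ) :
    (Finset.univ.filter (fun x : Fˣ => x ^ k = y ^ k)).card = k := by
  have h1 := MonoidHom.card_fiber_eq_of_mem_range (powMonoidHom k : Fˣ →* Fˣ)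
    (x := y ^ k) (y := 1) ⟨y, rfl⟩ ⟨1, by simp⟩
  have h2 := IsCyclic.card_powMonoidHom_ker Fˣ k
  rw [Nat.card_eq_fintype_card (α := Fˣ), ← hkm, Nat.gcd_eq_right (Dvd.intro _ rfl)] at h2
  simp only [powMonoidHom_apply] at h1
  rw [h1]
  conv_rhs => rw [← h2]
  rw [Nat.card_eq_fintype_card, Fintype.card_subtype]
  simp [MonoidHom.mem_ker]

/-- The finite set of `n`-th powers of units of `F`. -/
def unitPowers (F : Type*) [Field F] [Fintype F] [DecidableEq F] (n : ℕ) : Finset Fˣ :=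
  Finset.univ.image (fun y : Fˣ => y ^ n)

theorem mem_unitPowers {n : ℕ} {x : Fˣ} : x ∈ unitPowers F n ↔ ∃ y : Fˣ, y ^ n = x := by
  simp [unitPowers]

theorem sum_units_pow {M : Type*} [AddCommMonoid M] {k m : ℕ} (hkm : k * m = Fintype.card Fˣ)
    (f : Fˣ → M) : ∑ y : Fˣ, f (y ^ k) = k • ∑ h ∈ unitPowers F k, f h := by
  rw [Finset.sum_comp f (fun y : Fˣ => y ^ k), Finset.smul_sum]
  refine Finset.sum_congr rfl fun h hh => ?_
  obtain ⟨y, -, rfl⟩ := Finset.mem_image.1 hh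
  rw [card_units_pow_eq hkm y]

theorem card_unitPowers {k m : ℕ} (hkm : k * m = Fintype.card Fˣ) :
    (unitPowers F k).card = m := by
  have h := sum_units_pow hkm (fun _ => 1)
  simp only [Finset.sum_const, Finset.card_univ, smul_eq_mul, mul_one] at h
  have hk : 0 < k := Nat.pos_of_ne_zero fun h => by
    have := Fintype.card_pos (α := Fˣ); simp [h] at hkm; omega
  exact Nat.eq_of_mul_eq_mul_left hk (by rw [← h, hkm])

theorem sum_eq_zero_add_sum_units {M : Type*} [AddCommMonoid M] (f : F → M) :
    ∑ x, f x = f 0 + ∑ y : Fˣ, f y := by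
  rw [← Finset.add_sum_erase _ _ (Finset.mem_univ (0 : F))]
  congr 1
  refine (Finset.sum_bij (fun (y : Fˣ) _ => (y : F)) ?_ ?_ ?_ ?_).symm
  · simp
  · intro a _ b _ h; exact Units.ext h
  · intro b hb; exact ⟨Units.mk0 b (Finset.ne_of_mem_erase hb), Finset.mem_univ _, rfl⟩
  · simp

end CyclicPowers

/-! ### A Frobenius-invariant additive character. -/

section FrobeniusCharacter

variable {F : Type*} [Field F] [Fintype F]

theorem exists_ringHom_pow {q m : ℕ} (hq : IsPrimePow q) (hF : Fintype.card F = q ^ m) : ∃ φ : F →+* F, ∀ x, φ x = x ^ q := by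
  obtain ⟨p, f, hp, hf, rfl⟩ := hq
  have hp' : p.Prime := hp.nat_prime
  obtain ⟨r, hr⟩ := CharP.exists F
  have hrp : r.Prime := CharP.char_is_prime F r
  have := Fact.mk hrp
  obtain ⟨n, -, hn⟩ := FiniteField.card F r
  have hdvd : r ∣ p := by
    have : r ∣ (p ^ f) ^ m := by rw [← hF, hn]; exact dvd_pow_self _ n.ne_zero
    exact hrp.dvd_of_dvd_pow (hrp.dvd_of_dvd_pow this)
  obtain rfl := (Nat.prime_dvd_prime_iff_eq hrp hp').1 hdvd
  exact ⟨iterateFrobenius F r f, fun x => iterateFrobenius_def r f x⟩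

/-- A primitive additive character invariant under `x ↦ x ^ q` and trivial on the solutions of
`w ^ q = -w`. -/
theorem exists_frobenius_invariant_addChar {q β : ℕ} (hq : 2 ≤ q) (hβ : 1 ≤ β)
    (hF : Fintype.card F = q ^ (2 * β)) (φ : F →+* F) (hφ : ∀ x, φ x = x ^ q) :
    ∃ ψ : AddChar F ℂ, ψ.IsPrimitive ∧ (∀ x, ψ (x ^ q) = ψ x) ∧ ∀ w, w ^ q = -w → ψ w = 1 := by
  have hiter : ∀ j x, (φ ^ j) x = x ^ q ^ j := by
    intro j x
    induction j with
    | zero => simp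
    | succ j ih => rw [pow_succ', RingHom.mul_def, RingHom.comp_apply, ih, hφ, ← pow_mul, pow_succ]
  -- A trace-like map: Frobenius permutes its terms cyclically, and on solutions of `w ^ q = -w`
  -- consecutive terms cancel, their number `2 * β` being even.
  let T : F →+ F := ∑ j ∈ Finset.range (2 * β), ((φ ^ j : F →+* F) : F →+ F)
  have hT : ∀ x, T x = ∑ j ∈ Finset.range (2 * β), x ^ q ^ j := by
    intro x
    simp [T, AddMonoidHom.finsetSum_apply, hiter]
  have hTq : ∀ x, T (x ^ q) = T x := by
    intro x
    rw [hT, hT]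
    have h1 := Finset.sum_range_succ (fun j => x ^ q ^ j) (2 * β)
    rw [Finset.sum_range_succ', ← hF, FiniteField.pow_card, pow_zero, pow_one] at h1
    rw [← add_right_cancel h1]
    exact Finset.sum_congr rfl fun j _ => by rw [← pow_mul, pow_succ']
  have hsum : ∀ w : F, w ^ q = -w → ∀ b, ∑ j ∈ Finset.range (2 * b), w ^ q ^ j = 0 := by
    intro w hw b
    induction b with
    | zero => simp
    | succ b ih =>
      rw [show 2 * (b + 1) = 2 * b + 1 + 1 by ring, Finset.sum_range_succ,
        Finset.sum_range_succ, ih, pow_succ' q (2 * b), pow_mul w q, hw, ← hiter, ← hiter, map_neg]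
      ring
  have hTw : ∀ w, w ^ q = -w → T w = 0 := fun w hw => by rw [hT, hsum w hw]
  -- As a polynomial, `T` has degree below `|F|` and its coefficient of `X` is `1`, so it cannot
  -- vanish on all of `F`.
  have hne : ∃ x, T x ≠ 0 := by
    by_contra! h
    let P : Polynomial F := ∑ j ∈ Finset.range (2 * β), Polynomial.X ^ q ^ j
    have hP : P = 0 := by
      refine Polynomial.eq_zero_of_natDegree_lt_card_of_eval_eq_zero P
        (f := (id : F → F)) Function.injective_id ?_ ?_
      · intro x
        rw [← h x, hT]
        simp [P, Polynomial.eval_finsetSum]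
      · have : P.natDegree ≤ q ^ (2 * β - 1) := by
          refine Polynomial.natDegree_sum_le_of_forall_le _ _ fun j hj => ?_
          rw [Polynomial.natDegree_X_pow]
          exact Nat.pow_le_pow_right (by omega) (by have := Finset.mem_range.1 hj; omega)
        refine this.trans_lt ?_
        rw [hF]
        exact Nat.pow_lt_pow_right (by omega) (by omega)
    have hc : P.coeff 1 = 1 := by
      simp only [P, Polynomial.finsetSum_coeff, Polynomial.coeff_X_pow]
      rw [Finset.sum_eq_single 0]
      · simp
      · intro j _ hj
        have := Nat.one_lt_pow hj (show 1 < q by omega)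
        rw [if_neg (by omega)]
      · intro h0; exact absurd (Finset.mem_range.2 (by omega)) h0
    rw [hP] at hc
    simp at hc
  obtain ⟨x, hx⟩ := hne
  obtain ⟨χ, hχ⟩ := AddChar.exists_apply_ne_zero.2 hx
  refine ⟨χ.compAddMonoidHom T, AddChar.IsPrimitive.of_ne_one ?_, ?_, ?_⟩
  · intro h
    exact hχ (by simpa using DFunLike.congr_fun h x)
  · intro x; simp [hTq]
  · intro w hw; simp [hTw w hw]

end FrobeniusCharacter

/-! ### Exponential sums of `(q + 1)`-th powers: square and sign. -/

section PowerSums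

variable {F : Type*} [Field F] [Fintype F] [DecidableEq F]

/-- The exponential sum `∑ x, ψ (b * x ^ n)`. -/
noncomputable def powerExpSum (ψ : AddChar F ℂ) (n : ℕ) (b : F) : ℂ := ∑ x, ψ (b * x ^ n)

omit [DecidableEq F] in
theorem powerExpSum_mul_pow (ψ : AddChar F ℂ) (n : ℕ) (b : F) (y : Fˣ) :
    powerExpSum ψ n (b * (y : F) ^ n) = powerExpSum ψ n b := by
  unfold powerExpSum
  rw [← Equiv.sum_comp (Units.mulLeft y) (fun x => ψ (b * x ^ n))]
  simp [mul_pow, mul_assoc]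

/-- The term at `0` gives the `1`; every other value `x ^ n` is hit exactly `n` times, so `θ` is a
sum of roots of unity. -/
theorem powerExpSum_eq_one_add (ψ : AddChar F ℂ) {n m : ℕ} (hnm : n * m = Fintype.card Fˣ)
    (b : F) : ∃ θ : ℂ, IsIntegral ℤ θ ∧ powerExpSum ψ n b = 1 + n * θ := by
  have hn : n ≠ 0 := fun h => by
    have := Fintype.card_pos (α := Fˣ); simp [h] at hnm; omega
  refine ⟨∑ h ∈ unitPowers F n, ψ (b * (h : F)), ?_, ?_⟩
  · refine IsIntegral.sum _ fun h _ => ?_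
    refine IsIntegral.of_pow (n := Fintype.card F) Fintype.card_pos ?_
    rw [← AddChar.map_nsmul_eq_pow, card_nsmul_eq_zero, AddChar.map_zero_eq_one]
    exact isIntegral_one
  · rw [powerExpSum, sum_eq_zero_add_sum_units, zero_pow hn, mul_zero, AddChar.map_zero_eq_one]
    have := sum_units_pow hnm (fun y : Fˣ => ψ (b * (y : F)))
    rw [← nsmul_eq_mul, ← this]
    simp

/-- As `-1` is a `(q + 1)`-th power, the sum at `b` equals the sum at `-b`. Multiplying the two and
substituting `x = y + z` cancels the terms in `y ^ (q + 1)`; invariance of `ψ` makes the cross terms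
linear in `y ^ q`, so orthogonality leaves only the `z` solving the equation. -/
theorem powerExpSum_sq {q : ℕ} {φ : F →+* F} (hφ : ∀ x, φ x = x ^ q)
    {ψ : AddChar F ℂ} (hψ : ψ.IsPrimitive) (hψq : ∀ x, ψ (x ^ q) = ψ x)
    (hψw : ∀ w, w ^ q = -w → ψ w = 1) (hneg : ∃ y : Fˣ, y ^ (q + 1) = -1) (b : F) :
    powerExpSum ψ (q + 1) b ^ 2 = Fintype.card F *
      ((Finset.univ.filter fun z : F => b * z + b ^ q * z ^ (q ^ 2) = 0).card : ℂ) := by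
  obtain ⟨y₀, hy₀⟩ := hneg
  have hb : powerExpSum ψ (q + 1) (-b) = powerExpSum ψ (q + 1) b := by
    rw [← powerExpSum_mul_pow ψ (q + 1) b y₀, ← Units.val_pow_eq_pow_val, hy₀]
    simp
  have hbij : Function.Bijective φ := Finite.injective_iff_bijective.1 φ.injective
  have hinner : ∀ k : F, ∑ y, ψ (y ^ q * k) = if k = 0 then (Fintype.card F : ℂ) else 0 := by
    intro k
    have h := AddChar.sum_mulShift k hψ
    push_cast at h
    rw [← h, ← Equiv.sum_comp (Equiv.ofBijective φ hbij) (fun y => ψ (y * k))]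
    simp [hφ]
  have hterm : ∀ y z : F, ψ (b * (y + z) ^ (q + 1)) * ψ (-b * y ^ (q + 1)) =
      ψ (b * z ^ (q + 1)) * ψ (y ^ q * (b * z + b ^ q * z ^ (q ^ 2))) := by
    intro y z
    have h1 : (y + z) ^ q = y ^ q + z ^ q := by rw [← hφ, map_add, hφ, hφ]
    have h2 : ψ (y ^ q * (b ^ q * z ^ (q ^ 2))) = ψ (y * (b * z ^ q)) := by
      rw [← hψq (y * (b * z ^ q)), mul_pow, mul_pow, ← pow_mul, sq]
    rw [mul_add, AddChar.map_add_eq_mul, h2, ← AddChar.map_add_eq_mul, ← AddChar.map_add_eq_mul,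
      ← AddChar.map_add_eq_mul, pow_succ (y + z), h1]
    congr 1
    ring
  rw [sq]
  nth_rewrite 2 [← hb]
  unfold powerExpSum
  rw [Finset.sum_mul_sum, Finset.sum_comm]
  calc ∑ y, ∑ x, ψ (b * x ^ (q + 1)) * ψ (-b * y ^ (q + 1))
      = ∑ y, ∑ z, ψ (b * (y + z) ^ (q + 1)) * ψ (-b * y ^ (q + 1)) := by
        refine Finset.sum_congr rfl fun y _ => ?_
        rw [← Equiv.sum_comp (Equiv.addLeft y)]
        simp
    _ = ∑ z, ψ (b * z ^ (q + 1)) * ∑ y, ψ (y ^ q * (b * z + b ^ q * z ^ (q ^ 2))) := by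
        rw [Finset.sum_comm]
        simp_rw [hterm, Finset.mul_sum]
    _ = ∑ z, if b * z + b ^ q * z ^ (q ^ 2) = 0 then (Fintype.card F : ℂ) else 0 := by
        refine Finset.sum_congr rfl fun z _ => ?_
        rw [hinner]
        split_ifs with hz
        -- On these `z` the element `w = b * z ^ (q + 1)` satisfies `w ^ q = -w`, so its character
        -- value is `1`.
        · rw [hψw, one_mul]
          have : b ^ q * z ^ (q ^ 2) = -(b * z) := by linear_combination hz
          rw [mul_pow, ← pow_mul, show (q + 1) * q = q ^ 2 + q by ring, pow_add, ← mul_assoc, this]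
          ring
        · simp
    _ = _ := by rw [← Finset.sum_filter, Finset.sum_const, nsmul_eq_mul, mul_comm]

/-- Since `(-q) ^ k` is `1` modulo `q + 1`, the opposite sign would make `θ` a rational algebraic
integer, hence an integer, and force `q + 1 ∣ 2`. -/
theorem eq_of_sq_eq_of_eq_one_add {q k : ℕ} (hq : 2 ≤ q) {S θ : ℂ} (hθ : IsIntegral ℤ θ)
    (hS : S = 1 + (q + 1 : ℕ) * θ) (hsq : S ^ 2 = ((q ^ k : ℕ) : ℂ) ^ 2) :
    S = (((-(q : ℤ)) ^ k : ℤ) : ℂ) := by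
  have hq1 : ((q + 1 : ℕ) : ℂ) ≠ 0 := by exact_mod_cast Nat.succ_ne_zero q
  have hsq' : S ^ 2 = (((-(q : ℤ)) ^ k : ℤ) : ℂ) ^ 2 := by
    rw [hsq]
    push_cast
    rw [← pow_mul, ← pow_mul, mul_comm, pow_mul, pow_mul, neg_sq]
  rcases sq_eq_sq_iff_eq_or_eq_neg.1 hsq' with h | h
  · exact h
  exfalso
  have hmod : ((q + 1 : ℕ) : ℤ) ∣ (-(q : ℤ)) ^ k - 1 := by
    have h1 := sub_dvd_pow_sub_pow (-(q : ℤ)) 1 k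
    rw [one_pow] at h1
    refine dvd_trans ⟨-1, by push_cast; ring⟩ h1
  have hθq : θ = algebraMap ℚ ℂ ((-(-(q : ℚ)) ^ k - 1) / (q + 1 : ℕ)) := by
    have h2 : (q + 1 : ℕ) * θ = -(((-(q : ℤ)) ^ k : ℤ) : ℂ) - 1 := by
      rw [← h, hS]; ring
    rw [eq_comm, eq_ratCast]
    push_cast at h2 ⊢
    rw [← h2]
    push_cast at hq1
    field_simp
  rw [hθq, isIntegral_algebraMap_iff (algebraMap ℚ ℂ).injective] at hθ
  obtain ⟨m, hm⟩ := IsIntegrallyClosed.isIntegral_iff.1 hθ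
  have hm' : ((q + 1 : ℕ) : ℤ) * m = -(-(q : ℤ)) ^ k - 1 := by
    have hq2 : ((q + 1 : ℕ) : ℚ) ≠ 0 := by exact_mod_cast Nat.succ_ne_zero q
    rw [eq_div_iff hq2] at hm
    simp only [eq_intCast] at hm
    have : (m : ℚ) * ((q + 1 : ℕ) : ℚ) = -(-(q : ℚ)) ^ k - 1 := hm
    rw [mul_comm]
    exact_mod_cast this
  have h2 : ((q + 1 : ℕ) : ℤ) ∣ 2 := by
    have h3 := dvd_add hmod (Dvd.intro m hm')
    have h4 : ((-(q : ℤ)) ^ k - 1) + (-(-(q : ℤ)) ^ k - 1) = -2 := by ring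
    rw [h4] at h3
    exact (dvd_neg).1 h3
  have := Int.le_of_dvd (by norm_num) h2
  push_cast at this
  omega

end PowerSums

/-! ### Explicit evaluation of the exponential sums. -/

section SpecialClass

variable {F : Type*} [Field F] [Fintype F] [DecidableEq F]

theorem exists_mul_eq_card_units {q β : ℕ} (hF : Fintype.card F = q ^ (2 * β)) :
    ∃ M, (q ^ 2 - 1) * M = Fintype.card Fˣ := by
  have h := Nat.sub_dvd_pow_sub_pow (q ^ 2) 1 β
  rw [← pow_mul, one_pow, ← hF, ← Fintype.card_units] at h
  exact ⟨_, (h.choose_spec).symm⟩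

omit [Fintype F] [DecidableEq F] in
theorem neg_one_pow_eq_one_of_odd_or {q n : ℕ} {φ : F →+* F} (hφ : ∀ x, φ x = x ^ q)
    (h : Odd q → Even n) : (-1 : Fˣ) ^ n = 1 := by
  rcases Nat.even_or_odd q with hq | hq
  -- For even `q`, applying `φ` to `-1` gives `-1 = 1`, so no parity condition on `n` is needed.
  · have h1 : (-1 : Fˣ) = 1 := by
      have h2 := hφ (-1)
      rw [hq.neg_one_pow, map_neg, map_one] at h2
      ext
      simpa using h2
    rw [h1, one_pow]
  · exact (h hq).neg_one_pow

theorem card_filter_pow_eq_self {k m : ℕ} (hkm : k * m = Fintype.card Fˣ) :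
    (Finset.univ.filter fun z : F => z ^ (k + 1) = z).card = k + 1 := by
  have hk := card_units_pow_eq hkm 1
  have h1 := sum_eq_zero_add_sum_units (F := F) (fun z : F => if z ^ (k + 1) = z then 1 else 0)
  rw [Finset.card_filter, h1]
  conv_rhs => rw [← hk, add_comm, Finset.card_filter]
  congr 1
  · simp
  · refine Finset.sum_congr rfl fun y _ => ?_
    congr 1
    rw [one_pow, pow_succ, ← Units.val_pow_eq_pow_val, ← Units.val_mul, Units.val_inj, eq_iff_iff]
    exact mul_eq_right

theorem exists_pow_succ_eq_neg_one {q β : ℕ} (hF : Fintype.card F = q ^ (2 * β)) {φ : F →+* F} (hφ : ∀ x, φ x = x ^ q) :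
    ∃ m, (q + 1) * m = Fintype.card Fˣ ∧ ∃ y : Fˣ, y ^ (q + 1) = -1 := by
  obtain ⟨M, hM⟩ := exists_mul_eq_card_units hF
  rw [← one_pow 2, Nat.sq_sub_sq, mul_assoc] at hM
  refine ⟨_, hM, ?_⟩
  refine exists_pow_eq_of_pow_eq_one hM (neg_one_pow_eq_one_of_odd_or hφ fun h => ?_)
  exact (Nat.Odd.sub_odd h odd_one).mul_right _

theorem exists_powerExpSum_eq {q β : ℕ} (hq : 2 ≤ q)
    (hF : Fintype.card F = q ^ (2 * β)) {φ : F →+* F} (hφ : ∀ x, φ x = x ^ q)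
    {ψ : AddChar F ℂ} (hψ : ψ.IsPrimitive) (hψq : ∀ x, ψ (x ^ q) = ψ x)
    (hψw : ∀ w, w ^ q = -w → ψ w = 1) :
    ∃ c : Fˣ, ∀ b : Fˣ, powerExpSum ψ (q + 1) (b : F) =
      if b * c⁻¹ ∈ unitPowers F (q + 1) then (((-(q : ℤ)) ^ (β + 1) : ℤ) : ℂ)
      else (((-(q : ℤ)) ^ β : ℤ) : ℂ) := by
  obtain ⟨M, hM⟩ := exists_mul_eq_card_units hF
  have hfac : q ^ 2 - 1 = (q + 1) * (q - 1) := by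
    rw [← Nat.sq_sub_sq, one_pow]
  have hM1 : (q + 1) * ((q - 1) * M) = Fintype.card Fˣ := by rw [← hM, hfac, mul_assoc]
  have hM2 : (q - 1) * ((q + 1) * M) = Fintype.card Fˣ := by rw [← hM1]; ring
  obtain ⟨-, -, hneg⟩ := exists_pow_succ_eq_neg_one hF hφ
  -- This `c` has `c ^ q = -c`, so at `b = c` the root equation becomes `z ^ (q ^ 2) = z`, with `q ^
  -- 2` solutions.
  obtain ⟨c, hc⟩ : ∃ y : Fˣ, y ^ (q - 1) = -1 := by
    refine exists_pow_eq_of_pow_eq_one hM2 (neg_one_pow_eq_one_of_odd_or hφ fun h => ?_)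
    exact (h.add_odd odd_one).mul_right _
  have hqq : q = (q - 1) + 1 := by omega
  have hq2 : q ^ 2 = (q ^ 2 - 1) + 1 := by have := Nat.one_le_pow 2 q (by omega); omega
  have hcq : (c : F) ^ q = -c := by
    rw [hqq, pow_succ, ← Units.val_pow_eq_pow_val, hc]; simp
  refine ⟨c, fun b => ?_⟩
  have hsq := powerExpSum_sq hφ hψ hψq hψw hneg
  split_ifs with hb
  · obtain ⟨y, hy⟩ := mem_unitPowers.1 hb
    have hbc : (b : F) = c * (y : F) ^ (q + 1) := by
      rw [← Units.val_pow_eq_pow_val, hy, ← Units.val_mul]; simp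
    rw [hbc, powerExpSum_mul_pow]
    obtain ⟨θ, hθ, hS⟩ := powerExpSum_eq_one_add ψ hM1 (c : F)
    refine eq_of_sq_eq_of_eq_one_add hq hθ hS ?_
    rw [hsq]
    have hset : (Finset.univ.filter fun z : F => (c : F) * z + (c : F) ^ q * z ^ (q ^ 2) = 0) =
        Finset.univ.filter fun z : F => z ^ ((q ^ 2 - 1) + 1) = z := by
      ext z
      rw [← hq2, Finset.mem_filter, Finset.mem_filter, hcq]
      have : (c : F) * z + -(c : F) * z ^ (q ^ 2) = c * (z - z ^ (q ^ 2)) := by ring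
      rw [this, mul_eq_zero, sub_eq_zero]
      simp [eq_comm]
    rw [hset, card_filter_pow_eq_self hM, ← hq2, hF]
    push_cast
    ring
  · obtain ⟨θ, hθ, hS⟩ := powerExpSum_eq_one_add ψ hM1 (b : F)
    refine eq_of_sq_eq_of_eq_one_add hq hθ hS ?_
    rw [hsq]
    have hset : (Finset.univ.filter fun z : F => (b : F) * z + (b : F) ^ q * z ^ (q ^ 2) = 0) =
        {0} := by
      ext z
      rw [Finset.mem_filter, Finset.mem_singleton]
      refine ⟨fun ⟨_, hz⟩ => ?_, fun hz => by simp [hz, show q ≠ 0 by omega]⟩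
      by_contra hz0
      apply hb
      lift z to Fˣ using IsUnit.mk0 z hz0
      -- A nonzero root gives `b * z ^ (q + 1)` the same `(q - 1)`-th power as `c`; their quotient
      -- is then a `(q + 1)`-th power, which puts `b` in the coset of `c`.
      have h1 : b * z + b ^ q * z ^ (q ^ 2) = (b * z) * (1 + (b * z ^ (q + 1)) ^ (q - 1) : F) := by
        rw [mul_add, mul_one, mul_pow, ← pow_mul, mul_mul_mul_comm, ← hfac, ← pow_succ', ← pow_succ',
          ← hqq, ← hq2]
      rw [h1, mul_eq_zero, or_iff_right (by simp)] at hz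
      have h2 : (b * z ^ (q + 1)) ^ (q - 1) = -1 := by
        ext
        push_cast
        linear_combination hz
      have h3 : (b * z ^ (q + 1) * c⁻¹) ^ ((q - 1) * M) = 1 := by
        rw [pow_mul, mul_pow _ c⁻¹, inv_pow, h2, hc]; simp
      obtain ⟨y, hy⟩ := exists_pow_eq_of_pow_eq_one hM1 h3
      refine mem_unitPowers.2 ⟨y * z⁻¹, ?_⟩
      rw [mul_pow, hy, inv_pow]
      rw [mul_right_comm, mul_inv_cancel_right]
    rw [hset, hF, Finset.card_singleton]
    push_cast
    ring

end SpecialClass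

/-! ### Two-valued character sums of invariant sets, and Fourier inversion. -/

section UniformSets

variable {F : Type*} [Field F] [Fintype F] [DecidableEq F]

/-- `D` is a set of non-zero elements closed under multiplication by `n`-th powers. -/
structure IsPowerInvariant (n : ℕ) (D : Finset F) : Prop where
  zero_notMem : (0 : F) ∉ D
  mul_pow_mem : ∀ x ∈ D, ∀ y : Fˣ, x * (y : F) ^ n ∈ D

omit [Fintype F] [DecidableEq F] in
theorem IsPowerInvariant.mul_pow_mem_iff {n : ℕ} {D : Finset F} (hD : IsPowerInvariant n D)
    (x : F) (y : Fˣ) : x * (y : F) ^ n ∈ D ↔ x ∈ D := by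
  refine ⟨fun h => ?_, fun h => hD.mul_pow_mem x h y⟩
  have := hD.mul_pow_mem _ h y⁻¹
  rwa [mul_assoc, ← mul_pow, Units.mul_inv, one_pow, mul_one] at this

/-- The character sum of `D` at the frequency `a`. -/
noncomputable def charSum (ψ : AddChar F ℂ) (D : Finset F) (a : F) : ℂ := ∑ x ∈ D, ψ (a * x)

/-- The filter is the intersection of `D` with one coset of the `n`-th powers, and an invariant set
contains or misses a coset entirely. -/
theorem card_filter_mul_mem_powers {n m : ℕ} (hnm : n * m = Fintype.card Fˣ) {D : Finset F}
    (hD : IsPowerInvariant n D) (c a : Fˣ) :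
    (D.filter fun x => ∃ y : Fˣ, (a : F) * x = c * (y : F) ^ n).card =
      if (c : F) * (a : F)⁻¹ ∈ D then m else 0 := by
  have key : ∀ (x : F) (y : Fˣ), (a : F) * x = c * (y : F) ^ n ↔
      x = (c : F) * (a : F)⁻¹ * (y : F) ^ n := by
    intro x y
    have := a.ne_zero
    constructor
    · intro h; field_simp; rw [mul_comm] at h; linear_combination h
    · rintro rfl; field_simp
  split_ifs with h
  · rw [← card_unitPowers hnm]
    symm
    refine Finset.card_bij (fun g _ => (c : F) * (a : F)⁻¹ * (g : F)) ?_ ?_ ?_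
    · intro g hg
      obtain ⟨y, rfl⟩ := mem_unitPowers.1 hg
      rw [Finset.mem_filter]
      push_cast
      exact ⟨hD.mul_pow_mem _ h y, y, (key _ _).2 rfl⟩
    · intro g _ g' _ hgg
      exact Units.ext (mul_left_cancel₀ (by simp) hgg)
    · intro x hx
      obtain ⟨-, y, hy⟩ := Finset.mem_filter.1 hx
      exact ⟨y ^ n, mem_unitPowers.2 ⟨y, rfl⟩, by rw [(key _ _).1 hy]; push_cast; rfl⟩
  · rw [Finset.card_eq_zero, Finset.filter_eq_empty_iff]
    rintro x hx ⟨y, hy⟩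
    rw [(key _ _).1 hy, hD.mul_pow_mem_iff] at hx
    exact h hx

/-- Rescaling `D` by `y ^ n` leaves its character sum unchanged. Averaging over all units `y` turns
each summand into a power sum without its term at `0`, and `n * m = s ^ 2 - 1` then cancels. -/
theorem charSum_eq {n m : ℕ} (hnm : n * m = Fintype.card Fˣ) {s : ℤ}
    (hs : s ^ 2 = Fintype.card F) {ψ : AddChar F ℂ} {c : Fˣ}
    (hS : ∀ b : Fˣ, powerExpSum ψ n (b : F) =
      s - if b * c⁻¹ ∈ unitPowers F n then (n : ℂ) * s else 0)
    {D : Finset F} (hD : IsPowerInvariant n D) {t : ℤ} (ht : (D.card : ℤ) = t * (s + 1))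
    (a : Fˣ) :
    charSum ψ D a = t - if (c : F) * (a : F)⁻¹ ∈ D then (s : ℂ) else 0 := by
  have hn : n ≠ 0 := fun h => by
    have := Fintype.card_pos (α := Fˣ); simp [h] at hnm; omega
  have hN : (Fintype.card Fˣ : ℂ) ≠ 0 := by exact_mod_cast Fintype.card_ne_zero
  have hNs : (Fintype.card Fˣ : ℂ) = s ^ 2 - 1 := by
    have h1 : (Fintype.card F : ℤ) = Fintype.card Fˣ + 1 := by
      have := Fintype.card_units F
      have := Fintype.card_pos (α := F)
      omega
    have h2 : (Fintype.card Fˣ : ℤ) = s ^ 2 - 1 := by rw [hs, h1]; ring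
    exact_mod_cast congrArg (Int.cast : ℤ → ℂ) h2
  have htC : (D.card : ℂ) = t * (s + 1) := by exact_mod_cast congrArg (Int.cast : ℤ → ℂ) ht
  have hshift : ∀ y : Fˣ, charSum ψ D a = ∑ x ∈ D, ψ (a * x * (y : F) ^ n) := by
    intro y
    refine Finset.sum_bij' (fun x _ => x * ((y⁻¹ : Fˣ) : F) ^ n) (fun x _ => x * (y : F) ^ n)
      (fun x hx => hD.mul_pow_mem x hx _) (fun x hx => hD.mul_pow_mem x hx _) ?_ ?_ ?_
    · intro x _; rw [mul_assoc, ← mul_pow, Units.inv_mul, one_pow, mul_one]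
    · intro x _; rw [mul_assoc, ← mul_pow, Units.mul_inv, one_pow, mul_one]
    · intro x _; congr 1
      rw [mul_assoc, mul_assoc, ← mul_pow, Units.inv_mul, one_pow, mul_one]
  have hterm : ∀ x ∈ D, ∑ y : Fˣ, ψ (a * x * (y : F) ^ n) =
      (s - 1) - if ∃ y : Fˣ, (a : F) * x = c * (y : F) ^ n then (n : ℂ) * s else 0 := by
    intro x hx
    have hx0 : x ≠ 0 := fun h => hD.zero_notMem (h ▸ hx)
    lift x to Fˣ using IsUnit.mk0 x hx0
    have h1 := hS (a * x)
    rw [powerExpSum, sum_eq_zero_add_sum_units, zero_pow hn, mul_zero,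
      AddChar.map_zero_eq_one] at h1
    have h2 : a * x * c⁻¹ ∈ unitPowers F n ↔ ∃ y : Fˣ, (a : F) * x = c * (y : F) ^ n := by
      rw [mem_unitPowers]
      refine exists_congr fun y => ?_
      rw [eq_mul_inv_iff_mul_eq, mul_comm, eq_comm, ← Units.val_inj]
      push_cast
      rfl
    simp only [h2] at h1
    push_cast at h1
    linear_combination h1
  refine mul_left_cancel₀ hN ?_
  calc (Fintype.card Fˣ : ℂ) * charSum ψ D a = ∑ y : Fˣ, ∑ x ∈ D, ψ (a * x * (y : F) ^ n) := by
        rw [Finset.sum_congr rfl fun y _ => (hshift y).symm, Finset.sum_const, nsmul_eq_mul]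
        rfl
    _ = ∑ x ∈ D, ((s - 1) -
          if ∃ y : Fˣ, (a : F) * x = c * (y : F) ^ n then (n : ℂ) * s else 0) := by
        rw [Finset.sum_comm]
        exact Finset.sum_congr rfl hterm
    _ = D.card * (s - 1) - (if (c : F) * (a : F)⁻¹ ∈ D then m else 0 : ℕ) * (n * s) := by
        rw [Finset.sum_sub_distrib, Finset.sum_const, nsmul_eq_mul, ← Finset.sum_filter,
          Finset.sum_const, nsmul_eq_mul, card_filter_mul_mem_powers hnm hD]
    _ = _ := by
        have hnmC : (n : ℂ) * m = Fintype.card Fˣ := by exact_mod_cast congrArg Nat.cast hnm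
        rw [htC]
        split_ifs
        · linear_combination (-t : ℂ) * hNs - s * hnmC
        · push_cast
          linear_combination (-t : ℂ) * hNs

omit [Fintype F] [DecidableEq F] in
theorem IsPowerInvariant.neg_mem_iff {n : ℕ} (hneg : ∃ y : Fˣ, y ^ n = -1) {D : Finset F}
    (hD : IsPowerInvariant n D) (x : F) : -x ∈ D ↔ x ∈ D := by
  obtain ⟨y, hy⟩ := hneg
  rw [← hD.mul_pow_mem_iff x y, ← Units.val_pow_eq_pow_val, hy]
  simp

/-- The set of frequencies at which the character sum of `D` takes its exceptional value is again
invariant, and its character sum is exceptional exactly on `D`. -/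
theorem sum_dual_eq {n m : ℕ} (hnm : n * m = Fintype.card Fˣ) {s : ℤ}
    (hs : s ^ 2 = Fintype.card F) {ψ : AddChar F ℂ} {c : Fˣ}
    (hS : ∀ b : Fˣ, powerExpSum ψ n (b : F) =
      s - if b * c⁻¹ ∈ unitPowers F n then (n : ℂ) * s else 0)
    {D : Finset F} (hD : IsPowerInvariant n D) {t : ℤ} (ht : (D.card : ℤ) = t * (s + 1))
    (g : Fˣ) :
    (∑ a : Fˣ, if (c : F) * (a : F)⁻¹ ∈ D then ψ (g * a) else 0) =
      t - if (g : F) ∈ D then (s : ℂ) else 0 := by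
  let D' : Finset F := (D.image fun x => (c : F) * x⁻¹)
  have hinj : Set.InjOn (fun x => (c : F) * x⁻¹) D := by
    intro x _ y _ h
    exact inv_injective (mul_left_cancel₀ c.ne_zero h)
  have hcard : (D'.card : ℤ) = t * (s + 1) := by rw [Finset.card_image_of_injOn hinj, ht]
  have hmem : ∀ a : F, a ∈ D' ↔ (c : F) * a⁻¹ ∈ D := by
    intro a
    have := c.ne_zero
    simp only [D', Finset.mem_image]
    constructor
    · rintro ⟨x, hx, rfl⟩
      rwa [mul_inv, inv_inv, ← mul_assoc, mul_inv_cancel₀ this, one_mul]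
    · intro h
      exact ⟨_, h, by rw [mul_inv, inv_inv, ← mul_assoc, mul_inv_cancel₀ this, one_mul]⟩
  have hD' : IsPowerInvariant n D' := by
    refine ⟨fun h => hD.zero_notMem ?_, fun x hx y => ?_⟩
    · rw [hmem] at h; simpa using h
    · rw [hmem] at hx ⊢
      rw [mul_inv, ← inv_pow, ← mul_assoc, ← Units.val_inv_eq_inv_val]
      exact hD.mul_pow_mem _ hx _
  have h := charSum_eq hnm hs hS hD' hcard g
  have h2 : (c : F) * ((c : F) * (g : F)⁻¹)⁻¹ = g := by
    have := c.ne_zero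
    rw [mul_inv, inv_inv, ← mul_assoc, mul_inv_cancel₀ this, one_mul]
  simp only [hmem, h2] at h
  rw [← h, charSum, ← Finset.sum_filter]
  symm
  refine Finset.sum_bij' (fun a ha => Units.mk0 a (fun h0 => hD'.zero_notMem (h0 ▸ ha)))
    (fun a _ => (a : F)) ?_ ?_ ?_ ?_ ?_
  · intro a ha; simpa using (hmem a).1 ha
  · intro a ha; exact (hmem _).2 (Finset.mem_filter.1 ha).2
  · intro a ha; rfl
  · intro a ha; ext; rfl
  · intro a ha; rfl

theorem card_mul_count_extDiff {ψ : AddChar F ℂ} (hψ : ψ.IsPrimitive) (A B : Finset F) (g : F) :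
    (Fintype.card F : ℂ) * ((extDiff A B).count g : ℂ) =
      ∑ a, charSum ψ A a * charSum ψ B (-a) * ψ (-g * a) := by
  have h1 : (extDiff A B).count g =
      ((A ×ˢ B).filter fun p => p.1 - p.2 = g).card := by
    rw [extDiff, Multiset.count_map, Finset.card_def, Finset.filter_val]
    simp only [eq_comm]
  have h2 : ∀ a, charSum ψ A a * charSum ψ B (-a) * ψ (-g * a) =
      ∑ p ∈ A ×ˢ B, ψ (a * (p.1 - p.2 - g)) := by
    intro a
    rw [charSum, charSum, Finset.sum_mul_sum, ← Finset.sum_product', Finset.sum_mul]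
    refine Finset.sum_congr rfl fun p _ => ?_
    rw [← AddChar.map_add_eq_mul, ← AddChar.map_add_eq_mul]
    congr 1
    ring
  rw [Finset.sum_congr rfl fun a _ => h2 a, Finset.sum_comm, h1, Finset.card_filter, Nat.cast_sum,
    Finset.mul_sum]
  refine Finset.sum_congr rfl fun p _ => ?_
  have h3 := AddChar.sum_mulShift (p.1 - p.2 - g) hψ
  rw [h3]
  simp only [sub_eq_zero]
  split_ifs <;> simp

end UniformSets

/-! ### Exact difference counts for invariant sets. -/

section CountFormulas

variable {F : Type*} [Field F] [Fintype F] [DecidableEq F]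

/-- Fourier inversion with the two-valued sums inserted: frequency `0` gives `t ^ 2 * (s + 1) ^ 2`,
and the terms linear in an indicator are evaluated by `sum_dual_eq`. The remaining sum sees only the
dual of `A ∩ B`: it is empty for disjoint sets and is again covered by `sum_dual_eq` when `A = B`.
-/
theorem card_mul_count_extDiff_eq {n m : ℕ} (hnm : n * m = Fintype.card Fˣ)
    (hneg : ∃ y : Fˣ, y ^ n = -1) {s : ℤ}
    (hs : s ^ 2 = Fintype.card F) {ψ : AddChar F ℂ} (hψ : ψ.IsPrimitive) {c : Fˣ}
    (hS : ∀ b : Fˣ, powerExpSum ψ n (b : F) =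
      s - if b * c⁻¹ ∈ unitPowers F n then (n : ℂ) * s else 0)
    {A B : Finset F} (hA : IsPowerInvariant n A) (hB : IsPowerInvariant n B) {t : ℤ}
    (htA : (A.card : ℤ) = t * (s + 1)) (htB : (B.card : ℤ) = t * (s + 1)) (g : Fˣ) :
    (s : ℂ) ^ 2 * ((extDiff A B).count (g : F) : ℂ) =
      (s : ℂ) ^ 2 * (t ^ 2 + (if (g : F) ∈ A then (t : ℂ) else 0) +
        (if (g : F) ∈ B then (t : ℂ) else 0)) +
      s ^ 2 * ∑ a : Fˣ, if (c : F) * (a : F)⁻¹ ∈ A ∧ (c : F) * (a : F)⁻¹ ∈ B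
        then ψ (((-g : Fˣ) : F) * a) else 0 := by
  have hsC : (s : ℂ) ^ 2 = Fintype.card F := by exact_mod_cast congrArg (Int.cast : ℤ → ℂ) hs
  have hAC : (A.card : ℂ) = t * (s + 1) := by exact_mod_cast congrArg (Int.cast : ℤ → ℂ) htA
  have hBC : (B.card : ℂ) = t * (s + 1) := by exact_mod_cast congrArg (Int.cast : ℤ → ℂ) htB
  have h1 := card_mul_count_extDiff hψ A B (g : F)
  rw [sum_eq_zero_add_sum_units, ← hsC] at h1
  have hzero : ∀ D : Finset F, charSum ψ D 0 = D.card := by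
    intro D; simp [charSum]
  rw [neg_zero, hzero, hzero, mul_zero, AddChar.map_zero_eq_one, hAC, hBC] at h1
  have hone : ∑ a : Fˣ, ψ (((-g : Fˣ) : F) * a) = -1 := by
    have h2 := sum_eq_zero_add_sum_units (fun a : F => ψ (((-g : Fˣ) : F) * a))
    have h3 := AddChar.sum_mulShift (((-g : Fˣ) : F)) hψ
    rw [if_neg (Units.ne_zero _), Nat.cast_zero] at h3
    simp only [mul_comm _ (((-g : Fˣ) : F))] at h3
    rw [h3, mul_zero, AddChar.map_zero_eq_one] at h2
    linear_combination -h2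
  have hdA := sum_dual_eq hnm hs hS hA htA (-g)
  have hdB := sum_dual_eq hnm hs hS hB htB (-g)
  simp only [Units.val_neg, hA.neg_mem_iff hneg, hB.neg_mem_iff hneg] at hdA hdB
  have hterm : ∀ a : Fˣ, charSum ψ A a * charSum ψ B (-a) * ψ (-g * a) =
      t ^ 2 * ψ (((-g : Fˣ) : F) * a)
      - s * t * (if (c : F) * (a : F)⁻¹ ∈ A then ψ (-g * a) else 0)
      - s * t * (if (c : F) * (a : F)⁻¹ ∈ B then ψ (-g * a) else 0)
      + s ^ 2 * (if (c : F) * (a : F)⁻¹ ∈ A ∧ (c : F) * (a : F)⁻¹ ∈ B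
        then ψ (((-g : Fˣ) : F) * a) else 0) := by
    intro a
    have hB' := charSum_eq hnm hs hS hB htB (-a)
    have hcond : (c : F) * (-(a : F))⁻¹ ∈ B ↔ (c : F) * (a : F)⁻¹ ∈ B := by
      rw [inv_neg, mul_neg, hB.neg_mem_iff hneg]
    simp only [Units.val_neg, hcond] at hB'
    rw [charSum_eq hnm hs hS hA htA, hB', Units.val_neg]
    by_cases h1 : (c : F) * (a : F)⁻¹ ∈ A <;> by_cases h2 : (c : F) * (a : F)⁻¹ ∈ B <;>
      simp only [h1, h2, if_true, if_false, and_true, and_false, and_self] <;> ring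
  rw [Finset.sum_congr rfl fun a _ => hterm a, Finset.sum_add_distrib, Finset.sum_sub_distrib,
    Finset.sum_sub_distrib, ← Finset.mul_sum, ← Finset.mul_sum, ← Finset.mul_sum,
    ← Finset.mul_sum, hone, hdA, hdB] at h1
  rw [h1]
  split_ifs <;> ring

theorem count_extDiff_of_disjoint {n m : ℕ} (hnm : n * m = Fintype.card Fˣ)
    (hneg : ∃ y : Fˣ, y ^ n = -1) {s : ℤ}
    (hs : s ^ 2 = Fintype.card F) {ψ : AddChar F ℂ} (hψ : ψ.IsPrimitive) {c : Fˣ}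
    (hS : ∀ b : Fˣ, powerExpSum ψ n (b : F) =
      s - if b * c⁻¹ ∈ unitPowers F n then (n : ℂ) * s else 0)
    {A B : Finset F} (hA : IsPowerInvariant n A) (hB : IsPowerInvariant n B)
    (hAB : Disjoint A B) {t : ℤ}
    (htA : (A.card : ℤ) = t * (s + 1)) (htB : (B.card : ℤ) = t * (s + 1)) (g : Fˣ) :
    ((extDiff A B).count (g : F) : ℤ) =
      t ^ 2 + (if (g : F) ∈ A then t else 0) + (if (g : F) ∈ B then t else 0) := by
  have h := card_mul_count_extDiff_eq hnm hneg hs hψ hS hA hB htA htB g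
  have hs0 : (s : ℂ) ^ 2 ≠ 0 := by
    have hsC : (s : ℂ) ^ 2 = Fintype.card F := by exact_mod_cast congrArg (Int.cast : ℤ → ℂ) hs
    rw [hsC]; exact_mod_cast Fintype.card_ne_zero
  rw [Finset.sum_eq_zero, mul_zero, add_zero] at h
  · have h' := mul_left_cancel₀ hs0 h
    exact_mod_cast h'
  · intro a _
    exact if_neg fun hh => Finset.disjoint_left.1 hAB hh.1 hh.2

theorem count_extDiff_self {n m : ℕ} (hnm : n * m = Fintype.card Fˣ)
    (hneg : ∃ y : Fˣ, y ^ n = -1) {s : ℤ}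
    (hs : s ^ 2 = Fintype.card F) {ψ : AddChar F ℂ} (hψ : ψ.IsPrimitive) {c : Fˣ}
    (hS : ∀ b : Fˣ, powerExpSum ψ n (b : F) =
      s - if b * c⁻¹ ∈ unitPowers F n then (n : ℂ) * s else 0)
    {A : Finset F} (hA : IsPowerInvariant n A) {t : ℤ}
    (htA : (A.card : ℤ) = t * (s + 1)) (g : Fˣ) :
    ((extDiff A A).count (g : F) : ℤ) =
      t ^ 2 + t + (if (g : F) ∈ A then 2 * t - s else 0) := by
  have h := card_mul_count_extDiff_eq hnm hneg hs hψ hS hA hA htA htA g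
  have hs0 : (s : ℂ) ^ 2 ≠ 0 := by
    have hsC : (s : ℂ) ^ 2 = Fintype.card F := by exact_mod_cast congrArg (Int.cast : ℤ → ℂ) hs
    rw [hsC]; exact_mod_cast Fintype.card_ne_zero
  have hd := sum_dual_eq hnm hs hS hA htA (-g)
  simp only [Units.val_neg, hA.neg_mem_iff hneg] at hd
  simp only [and_self, Units.val_neg] at h
  rw [hd, ← mul_add] at h
  have h' := mul_left_cancel₀ hs0 h
  have h2 : (((extDiff A A).count (g : F) : ℤ) : ℂ) =
      ((t ^ 2 + t + (if (g : F) ∈ A then 2 * t - s else 0) : ℤ) : ℂ) := by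
    push_cast
    rw [h']
    split_ifs <;> ring
  exact_mod_cast h2

/-- The difference counts of sets invariant under multiplication by `(q + 1)`-th powers in a field
of order `q ^ (2 * β)`. -/
theorem exists_uniform_counts {q β : ℕ} (hq : IsPrimePow q) (hβ : 1 ≤ β)
    (hF : Fintype.card F = q ^ (2 * β)) {s : ℤ} (hs : s = (-(q : ℤ)) ^ β) :
    (∀ (A : Finset F) (t : ℤ), IsPowerInvariant (q + 1) A → (A.card : ℤ) = t * (s + 1) →
      ∀ g : F, g ≠ 0 → ((extDiff A A).count g : ℤ) =
        t ^ 2 + t + (if g ∈ A then 2 * t - s else 0)) ∧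
    (∀ (A B : Finset F) (t : ℤ), IsPowerInvariant (q + 1) A → IsPowerInvariant (q + 1) B →
      Disjoint A B → (A.card : ℤ) = t * (s + 1) → (B.card : ℤ) = t * (s + 1) →
      ∀ g : F, g ≠ 0 → ((extDiff A B).count g : ℤ) =
        t ^ 2 + (if g ∈ A then t else 0) + (if g ∈ B then t else 0)) := by
  have hq2 : 2 ≤ q := hq.two_le
  obtain ⟨φ, hφ⟩ := exists_ringHom_pow hq hF
  obtain ⟨ψ, hψ, hψq, hψw⟩ := exists_frobenius_invariant_addChar hq2 hβ hF φ hφ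
  obtain ⟨c, hc⟩ := exists_powerExpSum_eq hq2 hF hφ hψ hψq hψw
  obtain ⟨m, hnm, hneg⟩ := exists_pow_succ_eq_neg_one hF hφ
  have hs2 : s ^ 2 = Fintype.card F := by
    rw [hs, hF]
    push_cast
    rw [← pow_mul, mul_comm, pow_mul, neg_sq, ← pow_mul]
  have hS : ∀ b : Fˣ, powerExpSum ψ (q + 1) (b : F) =
      s - if b * c⁻¹ ∈ unitPowers F (q + 1) then ((q + 1 : ℕ) : ℂ) * s else 0 := by
    intro b
    rw [hc, hs]
    split_ifs
    · push_cast; ring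
    · simp
  refine ⟨fun A t hA ht g hg => ?_, fun A B t hA hB hAB htA htB g hg => ?_⟩
  · exact count_extDiff_self hnm hneg hs2 hψ hS hA ht (Units.mk0 g hg)
  · exact count_extDiff_of_disjoint hnm hneg hs2 hψ hS hA hB hAB htA htB (Units.mk0 g hg)

end CountFormulas

/-! ### Sizes, disjointness and invariance of unions of cyclotomic classes. -/

section CyclotomicClasses

variable {F : Type*} [Field F] [Fintype F] [DecidableEq F]

omit [DecidableEq F] in
theorem mem_cyclotomicClass {α : Fˣ} {e i : ℕ} {x : F} :
    x ∈ cyclotomicClass α e i ↔ ∃ y ∈ Subgroup.zpowers (α ^ e), x = ((α ^ i * y : Fˣ) : F) := by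
  simp [cyclotomicClass]

omit [DecidableEq F] in
theorem zero_notMem_cyclotomicClass (α : Fˣ) (e i : ℕ) : (0 : F) ∉ cyclotomicClass α e i := by
  rw [mem_cyclotomicClass]
  rintro ⟨y, -, h⟩
  exact (Units.ne_zero _) h.symm

theorem card_cyclotomicClass {α : Fˣ} (hα : ∀ x : Fˣ, x ∈ Subgroup.zpowers α) {e : ℕ}
    (he : e ∣ Fintype.card Fˣ) (i : ℕ) :
    (cyclotomicClass α e i).card = Fintype.card Fˣ / e := by
  classical
  have h1 : cyclotomicClass α e i =
      (Finset.univ.filter (fun y : Fˣ => y ∈ Subgroup.zpowers (α ^ e))).image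
        (fun y => ((α ^ i * y : Fˣ) : F)) := by
    ext x
    rw [mem_cyclotomicClass]
    simp [eq_comm]
  rw [h1, Finset.card_image_of_injective, ← Fintype.card_subtype, ← Nat.card_eq_fintype_card]
  · change Nat.card (Subgroup.zpowers (α ^ e)) = _
    rw [Nat.card_zpowers, orderOf_pow, orderOf_eq_card_of_forall_mem_zpowers hα,
      Nat.card_eq_fintype_card, Nat.gcd_eq_right he]
  · intro x y h
    exact mul_left_cancel (Units.ext h)

theorem disjoint_cyclotomicClass {α : Fˣ} (hα : ∀ x : Fˣ, x ∈ Subgroup.zpowers α) {e i j : ℕ}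
    (he : e ∣ Fintype.card Fˣ) (hi : i < e) (hj : j < e) (hij : i ≠ j) :
    Disjoint (cyclotomicClass α e i) (cyclotomicClass α e j) := by
  rw [Finset.disjoint_left]
  intro x hx hx'
  obtain ⟨y, hy, rfl⟩ := mem_cyclotomicClass.1 hx
  obtain ⟨z, hz, h⟩ := mem_cyclotomicClass.1 hx'
  obtain ⟨k, rfl⟩ := Subgroup.mem_zpowers_iff.1 hy
  obtain ⟨l, rfl⟩ := Subgroup.mem_zpowers_iff.1 hz
  have h1 : α ^ ((i : ℤ) + e * k) = α ^ ((j : ℤ) + e * l) := by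
    simpa [zpow_add, zpow_mul] using Units.ext h
  rw [zpow_eq_zpow_iff_modEq, orderOf_eq_card_of_forall_mem_zpowers hα,
    Nat.card_eq_fintype_card] at h1
  have h2 : (i : ℤ) + e * k ≡ (j : ℤ) + e * l [ZMOD (e : ℤ)] :=
    h1.of_dvd (by exact_mod_cast he)
  have h3 : (i : ℤ) ≡ j [ZMOD (e : ℤ)] := by
    simpa [Int.ModEq, Int.add_mul_emod_self_left] using h2
  have h4 := Int.natCast_modEq_iff.1 h3
  exact hij (h4.eq_of_lt_of_lt hi hj)

theorem isPowerInvariant_biUnion_cyclotomicClass {α : Fˣ}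
    (hα : ∀ x : Fˣ, x ∈ Subgroup.zpowers α) {e n : ℕ} (hen : e ∣ n) {ι : Type*} (J : Finset ι)
    (f : ι → ℕ) : IsPowerInvariant n (J.biUnion fun i => cyclotomicClass α e (f i)) := by
  refine ⟨fun h => ?_, fun x hx y => ?_⟩
  · obtain ⟨i, -, hi⟩ := Finset.mem_biUnion.1 h
    exact zero_notMem_cyclotomicClass α e _ hi
  · obtain ⟨i, hi, hx⟩ := Finset.mem_biUnion.1 hx
    refine Finset.mem_biUnion.2 ⟨i, hi, ?_⟩
    obtain ⟨z, hz, rfl⟩ := mem_cyclotomicClass.1 hx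
    refine mem_cyclotomicClass.2 ⟨z * y ^ n, mul_mem hz ?_, by push_cast; ring⟩
    obtain ⟨k, rfl⟩ := Subgroup.mem_zpowers_iff.1 (hα y)
    obtain ⟨d, rfl⟩ := hen
    refine Subgroup.mem_zpowers_iff.2 ⟨k * d, ?_⟩
    rw [← zpow_natCast, ← zpow_natCast, ← zpow_mul, ← zpow_mul]
    congr 1
    push_cast
    ring

theorem card_biUnion_cyclotomicClass {α : Fˣ} (hα : ∀ x : Fˣ, x ∈ Subgroup.zpowers α) {e : ℕ}
    (he : e ∣ Fintype.card Fˣ) (J : Finset (Fin e)) :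
    (J.biUnion fun i => cyclotomicClass α e (i : ℕ)).card = J.card * (Fintype.card Fˣ / e) := by
  rw [Finset.card_biUnion]
  · simp_rw [card_cyclotomicClass hα he]
    rw [Finset.sum_const, smul_eq_mul]
  · intro i _ j _ hij
    exact disjoint_cyclotomicClass hα he i.2 j.2 fun h => hij (Fin.ext h)

theorem disjoint_biUnion_cyclotomicClass {α : Fˣ} (hα : ∀ x : Fˣ, x ∈ Subgroup.zpowers α) {e : ℕ}
    (he : e ∣ Fintype.card Fˣ) {J K : Finset (Fin e)} (hJK : Disjoint J K) :
    Disjoint (J.biUnion fun i => cyclotomicClass α e (i : ℕ))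
      (K.biUnion fun i => cyclotomicClass α e (i : ℕ)) := by
  rw [Finset.disjoint_biUnion_left]
  intro i hi
  rw [Finset.disjoint_biUnion_right]
  intro j hj
  refine disjoint_cyclotomicClass hα he i.2 j.2 fun h => ?_
  exact Finset.disjoint_left.1 hJK hi ((Fin.ext h : i = j) ▸ hj)

end CyclotomicClasses

/-! ### From pointwise counts to families. -/

section DifferenceCounts

variable {G : Type*} [AddGroup G] [Fintype G] [DecidableEq G]

theorem mem_nonzeroElems {g : G} : g ∈ nonzeroElems G ↔ g ≠ 0 := by
  simp [nonzeroElems]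

omit [Fintype G] in
theorem count_zero_intDiff (A : Finset G) : (intDiff A).count 0 = 0 := by
  rw [Multiset.count_eq_zero, intDiff, Multiset.mem_map]
  rintro ⟨p, hp, h⟩
  exact (Finset.mem_offDiag.1 hp).2.2 (sub_eq_zero.1 h)

omit [Fintype G] in
theorem count_zero_extDiff {A B : Finset G} (h : Disjoint A B) : (extDiff A B).count 0 = 0 := by
  rw [Multiset.count_eq_zero, extDiff, Multiset.mem_map]
  rintro ⟨p, hp, hp'⟩
  obtain ⟨h1, h2⟩ := Finset.mem_product.1 hp
  rw [sub_eq_zero.1 hp'] at h1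
  exact Finset.disjoint_left.1 h h1 h2

omit [Fintype G] in
theorem count_intDiff {A : Finset G} {g : G} (hg : g ≠ 0) :
    (intDiff A).count g = (extDiff A A).count g := by
  rw [intDiff, extDiff, Multiset.count_map, Multiset.count_map, ← Finset.filter_val,
    ← Finset.filter_val, ← Finset.card_def, ← Finset.card_def]
  congr 1
  ext p
  simp only [Finset.mem_filter, Finset.mem_offDiag, Finset.mem_product]
  refine ⟨fun h => ⟨⟨h.1.1, h.1.2.1⟩, h.2⟩, fun h => ⟨⟨h.1.1, h.1.2, fun h' => hg ?_⟩, h.2⟩⟩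
  rw [h.2, h', sub_self]

theorem exists_eq_partial {M : Multiset G} {S : Finset G} {a d : ℤ} (h0 : M.count 0 = 0)
    (h : ∀ g, g ≠ 0 → (M.count g : ℤ) = a + if g ∈ S then d else 0)
    (hS0 : (0 : G) ∉ S) (hS : S.Nonempty) (ha : 0 ≤ a) :
    ∃ lam mu : ℕ, (lam : ℤ) = a + d ∧ (mu : ℤ) = a ∧
      M = lam • S.val + mu • (nonzeroElems G \ S).val := by
  obtain ⟨g₀, hg₀⟩ := hS
  have h1 := h g₀ fun h => hS0 (h ▸ hg₀)
  rw [if_pos hg₀] at h1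
  -- `S` may be all of the nonzero elements, so `mu` cannot be read off as a count outside `S`;
  -- hence the hypothesis `0 ≤ a`.
  refine ⟨M.count g₀, a.toNat, h1, Int.toNat_of_nonneg ha, ?_⟩
  ext g
  rw [Multiset.count_add, Multiset.count_nsmul, Multiset.count_nsmul,
    Multiset.count_eq_of_nodup S.nodup, Multiset.count_eq_of_nodup (Finset.nodup _)]
  simp only [Finset.mem_val, Finset.mem_sdiff, mem_nonzeroElems]
  by_cases hg : g = 0
  · subst hg; simp [h0, hS0]
  · have h2 := h g hg
    by_cases hgS : g ∈ S
    · simp only [hgS, if_true] at h2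
      simp [hgS]
      omega
    · simp only [hgS, if_false] at h2
      simp [hgS, hg]
      omega

/-- Both values `a + d` and `a` are attained, because `S` and its complement in the nonzero elements
are both inhabited. -/
theorem exists_eq_smul_nonzeroElems_iff {M : Multiset G} {S : Finset G} {a d : ℤ}
    (h0 : M.count 0 = 0) (h : ∀ g, g ≠ 0 → (M.count g : ℤ) = a + if g ∈ S then d else 0)
    (hS0 : (0 : G) ∉ S) (hS : S.Nonempty) (hS' : ∃ g, g ≠ 0 ∧ g ∉ S) :
    (∃ lam : ℕ, M = lam • (nonzeroElems G).val) ↔ d = 0 := by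
  obtain ⟨g₀, hg₀⟩ := hS
  obtain ⟨g₁, hg₁, hg₁S⟩ := hS'
  have hg₀0 : g₀ ≠ 0 := fun h => hS0 (h ▸ hg₀)
  have e₀ := h g₀ hg₀0
  have e₁ := h g₁ hg₁
  rw [if_pos hg₀] at e₀
  rw [if_neg hg₁S] at e₁
  have hcount : ∀ (lam : ℕ) (g : G), (lam • (nonzeroElems G).val).count g =
      if g ≠ 0 then lam else 0 := by
    intro lam g
    rw [Multiset.count_nsmul, Multiset.count_eq_of_nodup (Finset.nodup _)]
    simp [Finset.mem_val, mem_nonzeroElems]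
  constructor
  · rintro ⟨lam, rfl⟩
    rw [hcount, if_pos hg₀0] at e₀
    rw [hcount, if_pos hg₁] at e₁
    omega
  · rintro rfl
    refine ⟨M.count g₀, ?_⟩
    ext g
    rw [hcount]
    split_ifs with hg
    · have := h g hg
      simp only [ite_self] at this
      omega
    · rw [not_not.1 hg, h0]

omit [AddGroup G] [Fintype G] in
theorem sum_ite_mem_family {w : ℕ} {D : Fin w → Finset G}
    (hD : ∀ i j, i ≠ j → Disjoint (D i) (D j)) (g : G) (d : ℤ) :
    (∑ i, if g ∈ D i then d else 0) = if g ∈ familyUnion D then d else 0 := by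
  by_cases h : g ∈ familyUnion D
  · rw [if_pos h]
    obtain ⟨i, -, hi⟩ := Finset.mem_biUnion.1 h
    rw [Finset.sum_eq_single i, if_pos hi]
    · intro j _ hj
      exact if_neg fun hg => Finset.disjoint_left.1 (hD j i hj) hg hi
    · intro h'; exact absurd (Finset.mem_univ i) h'
  · rw [if_neg h]
    exact Finset.sum_eq_zero fun i _ =>
      if_neg fun hi => h (Finset.mem_biUnion.2 ⟨i, Finset.mem_univ i, hi⟩)

omit [Fintype G] in
theorem count_familyInt {w : ℕ} {D : Fin w → Finset G}
    (hD : ∀ i j, i ≠ j → Disjoint (D i) (D j)) {g : G} {a d : ℤ}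
    (h : ∀ i, ((intDiff (D i)).count g : ℤ) = a + if g ∈ D i then d else 0) :
    ((familyInt D).count g : ℤ) = w * a + if g ∈ familyUnion D then d else 0 := by
  rw [familyInt, Multiset.count_sum', Nat.cast_sum, Finset.sum_congr rfl fun i _ => h i,
    Finset.sum_add_distrib, sum_ite_mem_family hD]
  simp

omit [Fintype G] in
-- Sum over all ordered pairs and subtract the diagonal; by disjointness, `g` lies in at most one
-- member.
theorem count_familyExt {w : ℕ} {D : Fin w → Finset G}
    (hD : ∀ i j, i ≠ j → Disjoint (D i) (D j)) {g : G} {a d : ℤ}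
    (h : ∀ i j, i ≠ j → ((extDiff (D i) (D j)).count g : ℤ) =
      a + (if g ∈ D i then d else 0) + if g ∈ D j then d else 0) :
    ((familyExt D).count g : ℤ) =
      w * (w - 1) * a + if g ∈ familyUnion D then 2 * (w - 1) * d else 0 := by
  let f : Fin w × Fin w → ℤ := fun p =>
    a + (if g ∈ D p.1 then d else 0) + if g ∈ D p.2 then d else 0
  have hsum := sum_ite_mem_family hD g d
  have h1 : ((familyExt D).count g : ℤ) = ∑ p ∈ (Finset.univ : Finset (Fin w)).offDiag, f p := by
    rw [familyExt, Multiset.count_sum', Nat.cast_sum]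
    exact Finset.sum_congr rfl fun p hp => h _ _ (Finset.mem_offDiag.1 hp).2.2
  have h2 : ∑ p ∈ (Finset.univ : Finset (Fin w)).diag, f p +
      ∑ p ∈ (Finset.univ : Finset (Fin w)).offDiag, f p =
      ∑ i, ∑ j, f (i, j) := by
    rw [← Finset.sum_union (Finset.disjoint_diag_offDiag _), Finset.diag_union_offDiag,
      Finset.sum_product]
  have h3 : ∑ p ∈ (Finset.univ : Finset (Fin w)).diag, f p = ∑ i, f (i, i) := by
    rw [Finset.sum_diag]
  have h4 : ∑ i, f (i, i) = w * a + 2 * if g ∈ familyUnion D then d else 0 := by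
    simp only [f, Finset.sum_add_distrib, hsum]
    rw [Finset.sum_const, Finset.card_univ, Fintype.card_fin, nsmul_eq_mul]
    ring
  have hsum' : (∑ _j : Fin w, ∑ i, if g ∈ D i then d else 0) =
      w * if g ∈ familyUnion D then d else 0 := by
    simp only [hsum, Finset.sum_const, Finset.card_univ, Fintype.card_fin, nsmul_eq_mul]
  have h5 : ∑ i, ∑ j, f (i, j) =
      w * (w * a) + 2 * w * if g ∈ familyUnion D then d else 0 := by
    simp only [f, Finset.sum_add_distrib, hsum, Finset.sum_const, Finset.card_univ,
      Fintype.card_fin, nsmul_eq_mul]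
    rw [Finset.sum_comm, hsum']
    ring
  rw [h3, h4, h5] at h2
  rw [h1]
  split_ifs at h2 ⊢ <;> linear_combination h2

end DifferenceCounts

/-! ### Assembly of the four statements. -/

theorem mainTheorem4 {F : Type*} [Field F] [Fintype F] [DecidableEq F]
    (q β e u w : ℕ) (hq : IsPrimePow q) (hβ : 1 ≤ β) (hF : Fintype.card F = q ^ (2 * β))
    (he : 3 ≤ e) (heq : e ∣ q + 1) (hu : 1 ≤ u) (hw : 1 ≤ w) (hwu : w * u ≤ e)
    (α : Fˣ) (hα : ∀ x : Fˣ, x ∈ Subgroup.zpowers α)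
    (I : Fin w → Finset (Fin e)) (hIcard : ∀ a, (I a).card = u)
    (hIdisj : ∀ a b, a ≠ b → Disjoint (I a) (I b))
    (η : ℤ) (hη : η = cycEta q β e)
    (D : Fin w → Finset F)
    (hD : ∀ a, D a = (I a).biUnion (fun i => cyclotomicClass α e (i : ℕ))) :
    (∃ lam mu : ℕ,
      (lam : ℤ) = u ^ 2 * η ^ 2 + (3 * u - e) * η - 1 + (w - 1) * (u ^ 2 * η ^ 2 + u * η) ∧
      (mu : ℤ) = w * (u ^ 2 * η ^ 2 + u * η) ∧
      IsDPDF (q ^ (2 * β)) w (u * ((q ^ (2 * β) - 1) / e)) lam mu D) ∧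
    (2 ≤ w → ∃ lam mu : ℕ,
      (lam : ℤ) = w * (w - 1) * u ^ 2 * η ^ 2 + 2 * (w - 1) * u * η ∧
      (mu : ℤ) = w * (w - 1) * u ^ 2 * η ^ 2 ∧
      IsEPDF (q ^ (2 * β)) w (u * ((q ^ (2 * β) - 1) / e)) lam mu D) ∧
    (¬ PartitionsNonzero D →
      ((∃ n k lam : ℕ, IsDDF n w k lam D) ↔
        ∀ a, ∃ n k lam : ℕ, IsDifferenceSet n k lam (D a))) ∧
    (2 ≤ w → ¬ PartitionsNonzero D → ¬ ∃ n k lam : ℕ, IsEDF n w k lam D) := by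
  have hN : Fintype.card Fˣ = q ^ (2 * β) - 1 := by rw [Fintype.card_units, hF]
  have heN : e ∣ Fintype.card Fˣ := by
    obtain ⟨φ, hφ⟩ := exists_ringHom_pow hq hF
    obtain ⟨m, hm, -⟩ := exists_pow_succ_eq_neg_one hF hφ
    exact heq.trans ⟨m, hm.symm⟩
  obtain ⟨s, hs⟩ : ∃ s : ℤ, s = (-(q : ℤ)) ^ β := ⟨_, rfl⟩
  have hes : (e : ℤ) * η = s - 1 := by rw [hη, mul_cycEta β heq, hs]
  obtain ⟨t, ht⟩ : ∃ t : ℤ, t = u * η := ⟨_, rfl⟩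
  have hcard : ∀ a, (D a).card = u * ((q ^ (2 * β) - 1) / e) := fun a => by
    rw [hD, card_biUnion_cyclotomicClass hα heN, hIcard, hN]
  have hdisj : ∀ a b, a ≠ b → Disjoint (D a) (D b) := fun a b hab => by
    rw [hD, hD]
    exact disjoint_biUnion_cyclotomicClass hα heN (hIdisj a b hab)
  have hinv : ∀ a, IsPowerInvariant (q + 1) (D a) := fun a => by
    rw [hD]
    exact isPowerInvariant_biUnion_cyclotomicClass hα heq _ _
  have hfam : IsDisjointFamily (q ^ (2 * β)) w (u * ((q ^ (2 * β) - 1) / e)) D :=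
    ⟨hF, hcard, hdisj⟩
  have hcardZ : ∀ a, ((D a).card : ℤ) = t * (s + 1) := fun a => by
    have he0 : (e : ℤ) ≠ 0 := by exact_mod_cast (show e ≠ 0 by omega)
    refine mul_left_cancel₀ he0 ?_
    have h1 : e * ((q ^ (2 * β) - 1) / e) = q ^ (2 * β) - 1 := by
      rw [← hN]; exact Nat.mul_div_cancel' heN
    have h2 : ((q ^ (2 * β) - 1 : ℕ) : ℤ) = s ^ 2 - 1 := by
      rw [Nat.cast_sub (Nat.one_le_pow _ _ hq.pos), hs]
      push_cast
      rw [← pow_mul, mul_comm β 2, pow_mul, pow_mul, neg_sq]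
    have h3 : (e : ℤ) * (((q ^ (2 * β) - 1) / e : ℕ) : ℤ) = s ^ 2 - 1 := by
      rw [← h2, ← Nat.cast_mul, h1]
    rw [hcard, Nat.cast_mul, ht]
    linear_combination (u : ℤ) * h3 - u * (s + 1) * hes
  have hne : ∀ a, (D a).Nonempty := fun a => by
    rw [← Finset.card_pos, hcard, ← hN]
    exact Nat.mul_pos hu (Nat.div_pos (Nat.le_of_dvd Fintype.card_pos heN) (by omega))
  have ha₀ : ∃ _ : Fin w, True := ⟨⟨0, hw⟩, trivial⟩
  obtain ⟨a₀, -⟩ := ha₀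
  have hSne : (familyUnion D).Nonempty :=
    (hne a₀).mono (Finset.subset_biUnion_of_mem D (Finset.mem_univ a₀))
  have hS0 : (0 : F) ∉ familyUnion D := fun h => by
    obtain ⟨a, -, ha⟩ := Finset.mem_biUnion.1 h
    exact (hinv a).zero_notMem ha
  obtain ⟨hself, hext⟩ := exists_uniform_counts hq hβ hF hs
  have hInt : ∀ g : F, g ≠ 0 → ∀ a, ((intDiff (D a)).count g : ℤ) =
      (t ^ 2 + t) + if g ∈ D a then 2 * t - s else 0 := fun g hg a => by
    rw [count_intDiff hg, hself _ t (hinv a) (hcardZ a) g hg]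
  have hFI := fun (g : F) (hg : g ≠ 0) => count_familyInt hdisj (hInt g hg)
  have hFI0 : (familyInt D).count 0 = 0 := by
    rw [familyInt, Multiset.count_sum']
    exact Finset.sum_eq_zero fun i _ => count_zero_intDiff _
  have hFE := fun (g : F) (hg : g ≠ 0) => count_familyExt hdisj fun i j hij =>
    hext _ _ t (hinv i) (hinv j) (hdisj i j hij) (hcardZ i) (hcardZ j) g hg
  have hFE0 : (familyExt D).count 0 = 0 := by
    rw [familyExt, Multiset.count_sum']
    exact Finset.sum_eq_zero fun p hp =>
      count_zero_extDiff (hdisj _ _ (Finset.mem_offDiag.1 hp).2.2)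
  -- For odd `β` the integer `t` is negative, so this relies on integrality.
  have htt : 0 ≤ t ^ 2 + t := by
    rcases le_or_gt 0 t with h | h
    · positivity
    · nlinarith
  have hw0 : (0 : ℤ) ≤ (w : ℤ) - 1 := by omega
  have hcompl : ¬ PartitionsNonzero D → ∃ g : F, g ≠ 0 ∧ g ∉ familyUnion D := fun hpart => by
    by_contra! h
    refine hpart ⟨hne, hdisj, ?_⟩
    ext g
    rw [mem_nonzeroElems]
    exact ⟨fun hg hg0 => hS0 (hg0 ▸ hg), h g⟩
  refine ⟨?_, fun hw2 => ?_, fun hpart => ?_, fun hw2 hpart => ?_⟩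
  · obtain ⟨lam, mu, hlam, hmu, heq⟩ :=
      exists_eq_partial hFI0 hFI hS0 hSne (mul_nonneg (Nat.cast_nonneg w) htt)
    refine ⟨lam, mu, ?_, ?_, ⟨hfam, fun a => (hinv a).zero_notMem, heq⟩⟩
    -- Replacing `s` by `e * η + 1` produces the terms `-e * η - 1`.
    · rw [hlam, ht]; linear_combination hes
    · rw [hmu, ht]; ring
  · obtain ⟨lam, mu, hlam, hmu, heq⟩ := exists_eq_partial hFE0 hFE hS0 hSne
      (mul_nonneg (mul_nonneg (Nat.cast_nonneg w) hw0) (sq_nonneg t))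
    refine ⟨lam, mu, ?_, ?_, ⟨hfam, fun a => (hinv a).zero_notMem, heq⟩⟩
    · rw [hlam, ht]; ring
    · rw [hmu, ht]; ring
  · obtain ⟨g, hg, hgS⟩ := hcompl hpart
    -- The family and each single member are governed by the same equation `2 * t - s = 0`, so one
    -- member already decides the converse.
    have hDDF := exists_eq_smul_nonzeroElems_iff hFI0 hFI hS0 hSne ⟨g, hg, hgS⟩
    have hDS := fun a => exists_eq_smul_nonzeroElems_iff (count_zero_intDiff (D a))
      (fun g hg => hInt g hg a) (hinv a).zero_notMem (hne a) ⟨g, hg, fun h =>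
        hgS (Finset.mem_biUnion.2 ⟨a, Finset.mem_univ a, h⟩)⟩
    constructor
    · rintro ⟨n, k, lam, h⟩ a
      obtain ⟨lam', h'⟩ := (hDS a).2 (hDDF.1 ⟨lam, h.diff_eq⟩)
      exact ⟨_, _, lam', hF, hcard a, h'⟩
    · intro h
      obtain ⟨n, k, lam, h₀⟩ := h a₀
      obtain ⟨lam', h'⟩ := hDDF.2 ((hDS a₀).1 ⟨lam, h₀.diff_eq⟩)
      exact ⟨_, _, lam', hfam, h'⟩
  · rintro ⟨n, k, lam, h⟩
    have h0 := (exists_eq_smul_nonzeroElems_iff hFE0 hFE hS0 hSne (hcompl hpart)).1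
      ⟨lam, h.diff_eq⟩
    have hw1 : (2 * ((w : ℤ) - 1)) ≠ 0 := by omega
    -- Vanishing of `t` would make every member empty, its size being `t * (s + 1)`.
    have ht0 := (mul_eq_zero.1 h0).resolve_left hw1
    have h1 := hcardZ a₀
    rw [ht0, zero_mul] at h1
    exact (Finset.card_pos.2 (hne a₀)).ne' (by exact_mod_cast h1)
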